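/- Let $d\ge 1$ be an integer. Let $U$ be the hyperbolic plane, $E_8$ the positive $E_8$-lattice, and let $(V_{2d},\psi_{2d})=\bigl(\langle 2d\rangle\oplus U^{\oplus 2}\oplus E_8^{\oplus 2}\bigr)\otimes\mathbb{Q}$, a quadratic space of dimension $21$ and signature $(2-,19+)$; for $e\ge1$ define $(V_{2e},\psi_{2e})$ in the same way. Put $G=\mathrm{SO}(V_{2d},\psi_{2d})$, let $\mathbb{A}_f$ be the ring of finite adèles of $\mathbb{Q}$ and let $\mathbb{K}\subset G(\mathbb{A}_f)$ be a compact open subgroup. Let $\mathbb{S}=\mathrm{Res}_{\mathbb{C}/\mathbb{R}}\mathbb{G}_m$. A Hodge structure $h\colon\mathbb{S}\to\mathrm{GL}(W_\mathbb{R})$ acts on $W^{p,q}$ by $z^{-p}\bar z^{-q}$; in weight $0$ a polarization is an $h$-invariant form $s\colon W\times W\to\mathbb{Q}$ such that $s(x,h(i)y)$ is symmetric and positive definite on $W_\mathbb{R}$. Let $\Omega^{\pm}$ be the set of Hodge structures $h\colon\mathbb{S}\to G_\mathbb{R}$ on $V_{2d}$ with Hodge numbers $h^{-1,1}=h^{1,-1}=1$,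 $h^{0,0}=19$ for which $\psi_{2d}$ or $-\psi_{2d}$ is a polarization, and let $$Sh_\mathbb{K}(G,\Omega^\pm)_\mathbb{C}(\mathbb{C})=G(\mathbb{Q})\backslash\Omega^\pm\times G(\mathbb{A}_f)/\mathbb{K},\qquad q(x,g)k=(q\cdot x,qgk),$$ with $q\cdot x = (z\mapsto q\,x(z)\,q^{-1})$; write $[x,g]_\mathbb{K}$ for the class of $(x,g)$. A polarized $\mathbb{Q}$-Hodge structure of K3 type of degree $2e$ is a triple $(W,s,h)$ with $h\colon \mathbb{S}\to\mathrm{SO}(W,s)_\mathbb{R}$ a $\mathbb{Q}$-Hodge structure of type $\{(-1,1),(0,0),(1,-1)\}$ with Hodge numbers $1,19,1$, polarized by $s$, such that $(W,s)\cong(V_{2e},\psi_{2e})$ as quadratic spaces over $\mathbb{Q}$; it is of K3 type if this holds for some $e\ge 1$. Let $\mathcal{H}_\mathbb{K}$ be the collection of all $\bigl((W,h),s,\alpha\mathbb{K}\bigr)$ where $(W,s,h)$ is a polarized $\mathbb{Q}$-Hodge structure of K3 type and $\alpha\mathbb{K}$ is the $\mathbb{K}$-orbit of an $\mathbb{A}_f$-linear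 isomorphism $\alpha\colon V_{2d}\otimes\mathbb{A}_f\to W\otimes\mathbb{A}_f$ such that $\psi_{2d}(v_1,v_2)=m_s\cdot s(\alpha v_1,\alpha v_2)$ for all $v_1,v_2$, with some $m_s\in\mathbb{Q}_{>0}$, and such that the determinant of $\alpha$ with respect to $\mathbb{Q}$-bases of $V_{2d}$ and $W$ lies in $\mathbb{Q}^\times\subset\mathbb{A}_f^\times$. An isomorphism from $\bigl((W,h),s,\alpha\mathbb{K}\bigr)$ to $\bigl((W',h'),s',\alpha'\mathbb{K}\bigr)$ is an isomorphism $b\colon(W,h)\to(W',h')$ of $\mathbb{Q}$-Hodge structures such that $s=c\cdot s'\circ(b\times b)$ for some $c\in\mathbb{Q}^\times$ and $b\circ\alpha\in\alpha'\mathbb{K}$. Then for every $\bigl((W,h),s,\alpha\mathbb{K}\bigr)\in\mathcal{H}_\mathbb{K}$ and every representative $\alpha$ of $\alpha\mathbb{K}$ there is a $\mathbb{Q}$-linear isomorphism $a\colon W\to V_{2d}$ with $s=m_s^{-1}\cdot\psi_{2d}\circ(a\times a)$ and $a\circ\alpha\in G(\mathbb{A}_f)$. For every such $a$, the homomorphism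 $a\cdot h=(z\mapsto a\,h(z)\,a^{-1})$ lies in $\Omega^\pm$, and the class $[a\cdot h,a\circ\alpha]_\mathbb{K}$ depends neither on $a$ nor on the representative $\alpha$, and only on the isomorphism class of $\bigl((W,h),s,\alpha\mathbb{K}\bigr)$. The resulting map $$\mathcal{H}_\mathbb{K}/\{\text{isom.}\}\longrightarrow Sh_\mathbb{K}(G,\Omega^\pm)_\mathbb{C}(\mathbb{C}),\qquad \bigl((W,h),s,\alpha\mathbb{K}\bigr)\mapsto[a\cdot h,a\circ\alpha]_\mathbb{K}$$ is a bijection, and every point of $Sh_\mathbb{K}(G,\Omega^\pm)_\mathbb{C}(\mathbb{C})$ is the image of an object whose Hodge structure has degree $2d$ (so the map restricted to objects of degree $2d$ is a bijection as well). -/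

import Mathlib

open scoped TensorProduct

noncomputable section

namespace K3Shimura

/-! ### The quadratic spaces `(V_{2d}, ψ_{2d})` -/

/-- The index set of the standard basis of `L_{2d} = ⟨e₁ + d f₁⟩ ⊕ U ⊕ U ⊕ E₈ ⊕ E₈`
(rank `21`). -/
abbrev Idx : Type := Fin 1 ⊕ (Fin 2 ⊕ Fin 2) ⊕ (Fin 8 ⊕ Fin 8)

/-- The Gram matrix of the hyperbolic plane. -/
def gramU : Matrix (Fin 2) (Fin 2) ℤ := !![0, 1; 1, 0]

/-- The Gram matrix of `L_{2d}`. The vector `e₁ + d f₁` of the hyperbolic plane has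
self-pairing `2d`, and the Gram matrix of the positive lattice `E₈` is the Cartan matrix. -/
def gram (d : ℕ) : Matrix Idx Idx ℤ :=
  Matrix.fromBlocks !![2 * (d : ℤ)] 0 0
    (Matrix.fromBlocks (Matrix.fromBlocks gramU 0 0 gramU) 0 0
      (Matrix.fromBlocks CartanMatrix.E₈ 0 0 CartanMatrix.E₈))

/-- The vector space `V_{2d} = L_{2d} ⊗ ℚ`; only the form depends on `d`. -/
abbrev V : Type := Idx → ℚ

/-- The bilinear form `ψ_{2d}` on `V_{2d}`. -/
def ψ (d : ℕ) : LinearMap.BilinForm ℚ V :=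
  Matrix.toBilin' ((gram d).map (Int.cast : ℤ → ℚ))

/-- The ring of finite adèles of `ℚ`. -/
abbrev Af : Type := IsDedekindDomain.FiniteAdeleRing ℤ ℚ

/-! ### Special orthogonal groups -/

/-- The special orthogonal group of a bilinear form on an `R`-module. -/
def SO {R M : Type*} [CommRing R] [AddCommGroup M] [Module R M]
    (B : LinearMap.BilinForm R M) : Subgroup (M ≃ₗ[R] M) where
  carrier := {g | (∀ x y, B (g x) (g y) = B x y) ∧ LinearMap.det (g : M →ₗ[R] M) = 1}
  one_mem' := ⟨fun _ _ => rfl, LinearMap.det_id⟩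
  mul_mem' := by
    rintro a b ⟨ha, ha'⟩ ⟨hb, hb'⟩
    refine ⟨fun x y => ?_, ?_⟩
    · rw [LinearEquiv.mul_apply, LinearEquiv.mul_apply, ha, hb]
    · have : ((a * b : M ≃ₗ[R] M) : M →ₗ[R] M) = (a : M →ₗ[R] M) * (b : M →ₗ[R] M) := rfl
      rw [this, map_mul, ha', hb', one_mul]
  inv_mem' := by
    rintro a ⟨ha, ha'⟩
    refine ⟨fun x y => ?_, ?_⟩
    · have h := ha (a⁻¹ x) (a⁻¹ y)
      rw [← LinearEquiv.mul_apply, ← LinearEquiv.mul_apply, mul_inv_cancel] at h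
      exact h.symm
    · have : (a : M →ₗ[R] M) * ((a⁻¹ : M ≃ₗ[R] M) : M →ₗ[R] M) = 1 := by
        ext x
        exact a.apply_symm_apply x
      have h := congrArg LinearMap.det this
      rw [map_mul, ha', one_mul, map_one] at h
      exact h

/-- `G(ℚ)` for `G = SO(V_{2d}, ψ_{2d})`. -/
abbrev GQ (d : ℕ) : Subgroup (V ≃ₗ[ℚ] V) := SO (ψ d)

/-- `G(𝔸_f)` for `G = SO(V_{2d}, ψ_{2d})`. -/
abbrev GAf (d : ℕ) : Subgroup ((Af ⊗[ℚ] V) ≃ₗ[Af] (Af ⊗[ℚ] V)) := SO ((ψ d).baseChange Af)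

/-- The adelic topology on `G(𝔸_f)`: the one induced by the matrix entries with respect to a
rational basis. (Since `g⁻¹` is a polynomial in the entries of `g` on `SO`, this is also the
topology induced from the unit group of the matrix ring.) -/
instance adelicTopology (d : ℕ) : TopologicalSpace (GAf d) :=
  TopologicalSpace.induced
    (fun g => LinearMap.toMatrix
      (Algebra.TensorProduct.basis Af (Pi.basisFun ℚ Idx))
      (Algebra.TensorProduct.basis Af (Pi.basisFun ℚ Idx))
      ((g : (Af ⊗[ℚ] V) ≃ₗ[Af] (Af ⊗[ℚ] V)) : (Af ⊗[ℚ] V) →ₗ[Af] (Af ⊗[ℚ] V)))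
    inferInstance

/-! ### Hodge structures -/

section Hodge

variable {W W' W'' : Type} [AddCommGroup W] [Module ℚ W] [AddCommGroup W'] [Module ℚ W']
  [AddCommGroup W''] [Module ℚ W'']

/-- A homomorphism `𝕊(ℝ) = ℂˣ → GL(W_ℝ)`. It comes from a (unique) homomorphism of real
algebraic groups `𝕊 → GL(W_ℝ)` if and only if `W_ℂ` is spanned by the subspaces
`hodgePiece` below; this is part of `IsK3HodgeStructure`. -/
abbrev Rep (W : Type) [AddCommGroup W] [Module ℚ W] : Type :=
  ℂˣ →* ((ℝ ⊗[ℚ] W) ≃ₗ[ℝ] (ℝ ⊗[ℚ] W))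

/-- The subspace `W^{p,q}` of `W_ℂ`, on which `h(z)` acts as `z^{-p} z̄^{-q}`. -/
def hodgePiece (h : Rep W) (p q : ℤ) : Submodule ℂ (ℂ ⊗[ℝ] (ℝ ⊗[ℚ] W)) :=
  ⨅ z : ℂˣ, Module.End.eigenspace
    (((h z : (ℝ ⊗[ℚ] W) ≃ₗ[ℝ] (ℝ ⊗[ℚ] W)) : (ℝ ⊗[ℚ] W) →ₗ[ℝ] (ℝ ⊗[ℚ] W)).baseChange ℂ)
    ((z : ℂ) ^ (-p) * (starRingEnd ℂ (z : ℂ)) ^ (-q))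

/-- `h` is a `ℚ`-Hodge structure of type `{(-1,1), (0,0), (1,-1)}` with Hodge numbers
`h^{-1,1} = h^{1,-1} = 1` and `h^{0,0} = 19`. -/
structure IsK3HodgeStructure (h : Rep W) : Prop where
  type_eq : hodgePiece h (-1) 1 ⊔ hodgePiece h 0 0 ⊔ hodgePiece h 1 (-1) = ⊤
  finrank_neg : Module.finrank ℂ (hodgePiece h (-1) 1) = 1
  finrank_zero : Module.finrank ℂ (hodgePiece h 0 0) = 19
  finrank_pos : Module.finrank ℂ (hodgePiece h 1 (-1)) = 1

/-- The element `i` of `ℂˣ`. -/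
def unitI : ℂˣ := Units.mk0 Complex.I Complex.I_ne_zero

/-- `s` is a polarization of the weight-zero Hodge structure `h`: it is a morphism of Hodge
structures `W ⊗ W → ℚ(0)`, and `s(x, h(i) y)` is symmetric and positive definite on `W_ℝ`. -/
structure IsPolarization (s : LinearMap.BilinForm ℚ W) (h : Rep W) : Prop where
  invariant : ∀ z x y, s.baseChange ℝ (h z x) (h z y) = s.baseChange ℝ x y
  symm : ∀ x y, s.baseChange ℝ x (h unitI y) = s.baseChange ℝ y (h unitI x)
  pos : ∀ x, x ≠ 0 → 0 < s.baseChange ℝ x (h unitI x)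

/-- `(W, s, h)` is a polarized `ℚ`-Hodge structure of K3 type of degree `2d`. -/
structure IsPolarizedK3OfDegree (d : ℕ) (s : LinearMap.BilinForm ℚ W) (h : Rep W) : Prop where
  mem_SO : ∀ z, h z ∈ SO (s.baseChange ℝ)
  hodge : IsK3HodgeStructure h
  polarization : IsPolarization s h
  equivalent : ∃ u : W ≃ₗ[ℚ] V, ∀ x y, ψ d (u x) (u y) = s x y

/-- `(W, s, h)` is a polarized `ℚ`-Hodge structure of K3 type, of some degree. -/
def IsPolarizedK3 (s : LinearMap.BilinForm ℚ W) (h : Rep W) : Prop :=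
  ∃ e : ℕ, 0 < e ∧ IsPolarizedK3OfDegree e s h

/-- Base change of a `ℚ`-linear isomorphism. -/
abbrev bc (R : Type) [CommRing R] [Algebra ℚ R] (a : W ≃ₗ[ℚ] W') :
    (R ⊗[ℚ] W) ≃ₗ[R] (R ⊗[ℚ] W') :=
  LinearEquiv.baseChange ℚ R W W' a

/-- Transport of structure: `a · h = (z ↦ a ∘ h(z) ∘ a⁻¹)`. -/
def transport (a : W ≃ₗ[ℚ] W') (h : Rep W) : Rep W' where
  toFun z := ((bc ℝ a).symm ≪≫ₗ h z) ≪≫ₗ bc ℝ a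
  map_one' := by ext x; simp
  map_mul' z w := by ext x; simp

theorem bc_refl (R : Type) [CommRing R] [Algebra ℚ R] :
    bc R (LinearEquiv.refl ℚ W) = LinearEquiv.refl R (R ⊗[ℚ] W) := by
  apply LinearEquiv.toLinearMap_injective
  ext x
  simp

theorem bc_trans (R : Type) [CommRing R] [Algebra ℚ R] (a : W ≃ₗ[ℚ] W') (b : W' ≃ₗ[ℚ] W'') :
    bc R (a ≪≫ₗ b) = bc R a ≪≫ₗ bc R b := by
  apply LinearEquiv.toLinearMap_injective
  ext x
  simp

theorem bc_symm (R : Type) [CommRing R] [Algebra ℚ R] (a : W ≃ₗ[ℚ] W') :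
    bc R a.symm = (bc R a).symm := by
  apply LinearEquiv.toLinearMap_injective
  ext x
  simp

theorem transport_refl (h : Rep W) : transport (LinearEquiv.refl ℚ W) h = h := by
  ext z x
  simp [transport, bc_refl]

theorem transport_trans (a : W ≃ₗ[ℚ] W') (b : W' ≃ₗ[ℚ] W'') (h : Rep W) :
    transport (a ≪≫ₗ b) h = transport b (transport a h) := by
  ext z x
  simp [transport, bc_trans]

theorem transport_symm {a : W ≃ₗ[ℚ] W'} {h : Rep W} {h' : Rep W'} (H : transport a h = h') :
    transport a.symm h' = h := by
  rw [← H, ← transport_trans, LinearEquiv.self_trans_symm, transport_refl]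

end Hodge

/-! ### The Shimura variety -/

/-- The domain `Ω^±`: all Hodge structures `h : 𝕊 → SO(V_{2d}, ψ_{2d})_ℝ` with Hodge numbers
`(1, 19, 1)` for which `ψ_{2d}` or `-ψ_{2d}` is a polarization. -/
def Ω (d : ℕ) : Set (Rep V) :=
  {h | (∀ z, h z ∈ SO ((ψ d).baseChange ℝ)) ∧ IsK3HodgeStructure h ∧
    (IsPolarization (ψ d) h ∨ IsPolarization (-ψ d) h)}

/-- `(x, g) ∼ (q x, q g k)` for `q ∈ G(ℚ)` and `k ∈ K`. -/
def shSetoid (d : ℕ) (K : Subgroup (GAf d)) : Setoid (Ω d × GAf d) where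
  r p p' := ∃ q ∈ GQ d, ∃ k ∈ K, (p'.1 : Rep V) = transport q (p.1 : Rep V) ∧
    (p'.2 : (Af ⊗[ℚ] V) ≃ₗ[Af] (Af ⊗[ℚ] V)) = bc Af q * p.2 * k
  iseqv := by
    refine ⟨fun p => ?_, ?_, ?_⟩
    · refine ⟨1, one_mem _, 1, one_mem _, (transport_refl _).symm, ?_⟩
      have : bc Af (1 : V ≃ₗ[ℚ] V) = 1 := bc_refl Af
      rw [this]
      simp
    · rintro p p' ⟨q, hq, k, hk, h1, h2⟩
      refine ⟨q⁻¹, inv_mem hq, k⁻¹, inv_mem hk, (transport_symm h1.symm).symm, ?_⟩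
      have : bc Af (q⁻¹ : V ≃ₗ[ℚ] V) = (bc Af q)⁻¹ := bc_symm Af q
      rw [this, h2]
      simp [mul_assoc]
    · rintro p p' p'' ⟨q, hq, k, hk, h1, h2⟩ ⟨q', hq', k', hk', h1', h2'⟩
      refine ⟨q' * q, mul_mem hq' hq, k * k', mul_mem hk hk', ?_, ?_⟩
      · rw [h1', h1]
        exact (transport_trans q q' _).symm
      · have : bc Af (q' * q : V ≃ₗ[ℚ] V) = bc Af q' * bc Af q := bc_trans Af q q'
        rw [this, h2', h2]
        simp [mul_assoc]

/-- The set `G(ℚ) \ Ω^± × G(𝔸_f) / K` of complex points of the Shimura variety. -/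
def Sh (d : ℕ) (K : Subgroup (GAf d)) : Type := Quotient (shSetoid d K)

/-- The class `[x, g]_K`. -/
def Sh.mk {d : ℕ} (K : Subgroup (GAf d)) (x : Ω d) (g : GAf d) : Sh d K :=
  Quotient.mk (shSetoid d K) (x, g)

/-! ### Hodge structures with a level structure -/

/-- `α : V_{2d} ⊗ 𝔸_f → W ⊗ 𝔸_f` satisfies `ψ_{2d}(v₁, v₂) = m · s(α v₁, α v₂)`. -/
def IsSimilitude {W : Type} [AddCommGroup W] [Module ℚ W] (d : ℕ)
    (s : LinearMap.BilinForm ℚ W) (m : ℚ) (α : (Af ⊗[ℚ] V) ≃ₗ[Af] (Af ⊗[ℚ] W)) : Prop :=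
  ∀ v₁ v₂, (ψ d).baseChange Af v₁ v₂ = algebraMap ℚ Af m * s.baseChange Af (α v₁) (α v₂)

/-- The determinant of `α`, computed with respect to rational bases, lies in `ℚ`; that is,
`det α` maps the rational line `⋀²¹ V_{2d}` to the rational line `⋀²¹ W`. -/
def HasRationalDet {W : Type} [AddCommGroup W] [Module ℚ W]
    (α : (Af ⊗[ℚ] V) ≃ₗ[Af] (Af ⊗[ℚ] W)) : Prop :=
  ∃ (u : V ≃ₗ[ℚ] W) (r : ℚ),
    LinearMap.det ((α ≪≫ₗ (bc Af u).symm : (Af ⊗[ℚ] V) ≃ₗ[Af] (Af ⊗[ℚ] V)) :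
      (Af ⊗[ℚ] V) →ₗ[Af] (Af ⊗[ℚ] V)) = algebraMap ℚ Af r

/-- The objects `((W, h), s, αK)`; the field `level` is the orbit `αK`. -/
structure HK (d : ℕ) (K : Subgroup (GAf d)) where
  W : Type
  [addCommGroup : AddCommGroup W]
  [module : Module ℚ W]
  h : Rep W
  s : LinearMap.BilinForm ℚ W
  isPolarizedK3 : IsPolarizedK3 s h
  level : Set ((Af ⊗[ℚ] V) ≃ₗ[Af] (Af ⊗[ℚ] W))
  isLevel : ∃ α : (Af ⊗[ℚ] V) ≃ₗ[Af] (Af ⊗[ℚ] W),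
    (∃ m : ℚ, 0 < m ∧ IsSimilitude d s m α) ∧ HasRationalDet α ∧
    level = {β | ∃ k ∈ K, β = (k : (Af ⊗[ℚ] V) ≃ₗ[Af] (Af ⊗[ℚ] V)) ≪≫ₗ α}

attribute [instance] HK.addCommGroup HK.module

variable {d : ℕ} {K : Subgroup (GAf d)}

/-- Two objects are isomorphic if there is an isomorphism `b` of `ℚ`-Hodge structures with
`s = c · s' ∘ (b × b)` for some `c ∈ ℚˣ` and `b ∘ α ≡ α' (mod K)`. -/
def HK.Iso (X Y : HK d K) : Prop :=
  ∃ b : X.W ≃ₗ[ℚ] Y.W, transport b X.h = Y.h ∧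
    (∃ c : ℚ, c ≠ 0 ∧ ∀ x y, X.s x y = c * Y.s (b x) (b y)) ∧
    ∃ α ∈ X.level, α ≪≫ₗ bc Af b ∈ Y.level

theorem HK.level_mem (X : HK d K) {α β : (Af ⊗[ℚ] V) ≃ₗ[Af] (Af ⊗[ℚ] X.W)}
    (hα : α ∈ X.level) :
    β ∈ X.level ↔ ∃ k ∈ K, β = (k : (Af ⊗[ℚ] V) ≃ₗ[Af] (Af ⊗[ℚ] V)) ≪≫ₗ α := by
  obtain ⟨α₀, -, -, hl⟩ := X.isLevel
  rw [hl] at hα ⊢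
  obtain ⟨k, hk, rfl⟩ := hα
  constructor
  · rintro ⟨k', hk', rfl⟩
    refine ⟨k⁻¹ * k', mul_mem (inv_mem hk) hk', ?_⟩
    ext x
    simp [← LinearEquiv.mul_apply]
  · rintro ⟨k', hk', rfl⟩
    exact ⟨k * k', mul_mem hk hk', rfl⟩

theorem HK.level_nonempty (X : HK d K) : ∃ α, α ∈ X.level := by
  obtain ⟨α₀, -, -, hl⟩ := X.isLevel
  exact ⟨α₀, by rw [hl]; exact ⟨1, one_mem _, rfl⟩⟩

/-- Isomorphism in `HK` is an equivalence relation. -/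
instance HK.setoid (d : ℕ) (K : Subgroup (GAf d)) : Setoid (HK d K) where
  r := HK.Iso
  iseqv := by
    refine ⟨fun X => ?_, ?_, ?_⟩
    · obtain ⟨α, hα⟩ := X.level_nonempty
      refine ⟨LinearEquiv.refl ℚ X.W, transport_refl _, ⟨1, one_ne_zero, by simp⟩, α, hα, ?_⟩
      rwa [bc_refl, LinearEquiv.trans_refl]
    · rintro X Y ⟨b, hb, ⟨c, hc, hs⟩, α, hα, hα'⟩
      refine ⟨b.symm, transport_symm hb, ⟨c⁻¹, inv_ne_zero hc, fun x y => ?_⟩, _, hα', ?_⟩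
      · simp [hs, hc]
      · rwa [bc_symm, LinearEquiv.trans_assoc, LinearEquiv.self_trans_symm,
          LinearEquiv.trans_refl]
    · rintro X Y Z ⟨b, hb, ⟨c, hc, hs⟩, α, hα, hα'⟩ ⟨b', hb', ⟨c', hc', hs'⟩, β, hβ, hβ'⟩
      refine ⟨b ≪≫ₗ b', by rw [transport_trans, hb, hb'],
        ⟨c * c', mul_ne_zero hc hc', fun x y => by simp [hs, hs', mul_assoc]⟩, α, hα, ?_⟩
      obtain ⟨k, hk, e⟩ := (Y.level_mem hβ).1 hα'
      rw [bc_trans, ← LinearEquiv.trans_assoc, e, LinearEquiv.trans_assoc]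
      exact (Z.level_mem hβ').2 ⟨k, hk, rfl⟩

/-- The choices that enter the period point of `((W, h), s, αK)`: a representative `α` of the
orbit, its factor `m_s`, and an isomorphism `a : W → V_{2d}` with
`s = m_s⁻¹ · ψ_{2d} ∘ (a × a)` and `a ∘ α ∈ G(𝔸_f)`. -/
structure HK.Marking (X : HK d K) where
  α : (Af ⊗[ℚ] V) ≃ₗ[Af] (Af ⊗[ℚ] X.W)
  α_mem : α ∈ X.level
  m : ℚ
  m_pos : 0 < m
  similitude : IsSimilitude d X.s m α
  a : X.W ≃ₗ[ℚ] V
  form_eq : ∀ x y, X.s x y = m⁻¹ * ψ d (a x) (a y)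
  comp_mem : α ≪≫ₗ bc Af a ∈ GAf d

end K3Shimura

end

/-!
Over `ℚ`, the lattice `E₈` becomes a sum of eight squares. By Lagrange's theorem every positive
rational is a norm of rational quaternions, so quaternion multiplication gives the sum of four
squares, hence also `E₈`, a similitude of any positive factor; the hyperbolic plane has one too.
Now let `α` be a similitude of factor `m` from `V_{2d} ⊗ 𝔸_f` to `W ⊗ 𝔸_f`, where `W ≅ V_{2e}`.
If `det α` is a rational number `r`, comparing discriminants gives `d = m²¹ r² e`, which is exactly
what allows the line `⟨2e⟩` to be matched with `⟨2d⟩` as well. So `(W, m s) ≅ V_{2d}`, and since the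
dimension is odd, composing with `-1` makes the determinant of `a ∘ α` equal to `1`.

The remaining point is surjectivity, where `-ψ_{2d}` must be excluded as a polarization: `h(i)` is
the identity on a subspace of dimension `19`, on which `ψ_{2d}` would be negative definite, whereas
`ψ_{2d}` is positive definite on a subspace of dimension `3`, and `19 + 3 > 21`.
-/

noncomputable section

namespace K3Shimura

/-! ### Similitudes of bilinear forms -/

section FormSimilitude

variable {R M M' M'' : Type*} [CommRing R] [AddCommGroup M] [Module R M] [AddCommGroup M']
  [Module R M'] [AddCommGroup M''] [Module R M''] {B : LinearMap.BilinForm R M}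
  {B' : LinearMap.BilinForm R M'} {B'' : LinearMap.BilinForm R M''} {m n : R}

/-- `g` is a similitude from `B` to `B'` with factor `m`. As in `IsSimilitude`, the factor
multiplies the form on the target. -/
def IsFormSimilitude (m : R) (B : LinearMap.BilinForm R M) (B' : LinearMap.BilinForm R M')
    (g : M ≃ₗ[R] M') : Prop :=
  ∀ x y, B x y = m * B' (g x) (g y)

namespace IsFormSimilitude

theorem trans {g : M ≃ₗ[R] M'} {g' : M' ≃ₗ[R] M''} (hg : IsFormSimilitude m B B' g)
    (hg' : IsFormSimilitude n B' B'' g') : IsFormSimilitude (m * n) B B'' (g ≪≫ₗ g') :=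
  fun x y => by rw [hg, hg', mul_assoc]; rfl

theorem symm {g : M ≃ₗ[R] M'} (hg : IsFormSimilitude m B B' g) (hnm : n * m = 1) :
    IsFormSimilitude n B' B g.symm :=
  fun x y => by
    rw [hg, ← mul_assoc, hnm, one_mul, LinearEquiv.apply_symm_apply, LinearEquiv.apply_symm_apply]

theorem baseChange (S : Type*) [CommRing S] [Algebra R S] {g : M ≃ₗ[R] M'}
    (hg : IsFormSimilitude m B B' g) :
    IsFormSimilitude (algebraMap R S m) (B.baseChange S) (B'.baseChange S)
      (g.baseChange R S M M') := by
  intro x y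
  induction x with
  | zero => simp only [map_zero, LinearMap.zero_apply, mul_zero]
  | add x₁ x₂ h₁ h₂ => simp only [map_add, LinearMap.add_apply, h₁, h₂, mul_add]
  | tmul r w =>
    induction y with
    | zero => simp only [map_zero, mul_zero]
    | add y₁ y₂ h₁ h₂ => simp only [map_add, h₁, h₂, mul_add]
    | tmul r' w' =>
      rw [LinearEquiv.baseChange_tmul, LinearEquiv.baseChange_tmul,
        LinearMap.BilinForm.baseChange_tmul, LinearMap.BilinForm.baseChange_tmul, hg,
        mul_smul, Algebra.smul_def m]

theorem conj_mem_SO {g : M ≃ₗ[R] M'} (hg : IsFormSimilitude m B B' g) (hm : IsLeftRegular m)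
    {k : M ≃ₗ[R] M} (hk : k ∈ SO B) : (g.symm ≪≫ₗ k) ≪≫ₗ g ∈ SO B' := by
  refine ⟨fun x y => hm ?_, (LinearMap.det_conj _ g).trans hk.2⟩
  obtain ⟨x, rfl⟩ := g.surjective x
  obtain ⟨y, rfl⟩ := g.surjective y
  simpa [← hg _ _] using hk.1 x y

theorem det_toMatrix {ι : Type*} [Fintype ι] [DecidableEq ι] (b : Module.Basis ι R M)
    {B₁ B₂ : LinearMap.BilinForm R M} {g : M ≃ₗ[R] M} (hg : IsFormSimilitude m B₁ B₂ g) :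
    (LinearMap.BilinForm.toMatrix b B₁).det =
      m ^ Fintype.card ι * LinearMap.det (g : M →ₗ[R] M) ^ 2 *
        (LinearMap.BilinForm.toMatrix b B₂).det := by
  have hB : B₁ = m • B₂.comp (g : M →ₗ[R] M) (g : M →ₗ[R] M) := by
    ext x y
    exact hg x y
  rw [hB, map_smul, Matrix.det_smul, LinearMap.BilinForm.toMatrix_comp b b, Matrix.det_mul,
    Matrix.det_mul, Matrix.det_transpose, LinearMap.det_toMatrix]
  ring

end IsFormSimilitude

theorem mem_SO_iff {g : M ≃ₗ[R] M} :
    g ∈ SO B ↔ IsFormSimilitude 1 B B g ∧ LinearMap.det (g : M →ₗ[R] M) = 1 :=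
  and_congr_left fun _ => forall₂_congr fun _ _ => by rw [one_mul, eq_comm]

theorem isFormSimilitude_neg : IsFormSimilitude 1 B B (LinearEquiv.neg R) :=
  fun x y => by simp

theorem det_baseChange_linearEquiv (S : Type*) [CommRing S] [Algebra R S] [Module.Free R M]
    [Module.Finite R M] (g : M ≃ₗ[R] M) :
    LinearMap.det (g.baseChange R S M M : S ⊗[R] M →ₗ[S] S ⊗[R] M) =
      algebraMap R S (LinearMap.det (g : M →ₗ[R] M)) :=
  LinearMap.det_baseChange _

theorem baseChange_mem_SO_iff (S : Type*) [CommRing S] [Algebra R S] [FaithfulSMul R S]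
    [Module.Free R M] [Module.Finite R M] {g : M ≃ₗ[R] M} :
    g.baseChange R S M M ∈ SO (B.baseChange S) ↔ g ∈ SO B := by
  rw [mem_SO_iff, mem_SO_iff, det_baseChange_linearEquiv, FaithfulSMul.algebraMap_eq_one_iff]
  refine and_congr_left fun _ =>
    ⟨fun h x y => ?_, fun h => map_one (algebraMap R S) ▸ h.baseChange S⟩
  apply FaithfulSMul.algebraMap_injective R S
  simpa [Algebra.algebraMap_eq_smul_one] using h (1 ⊗ₜ x) (1 ⊗ₜ y)

theorem toMatrix_baseChange (S : Type*) [CommRing S] [Algebra R S] {ι : Type*} [Fintype ι]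
    [DecidableEq ι] (b : Module.Basis ι R M) (B : LinearMap.BilinForm R M) :
    LinearMap.BilinForm.toMatrix (Algebra.TensorProduct.basis S b) (B.baseChange S) =
      (LinearMap.BilinForm.toMatrix b B).map (algebraMap R S) := by
  ext i j
  simp [LinearMap.BilinForm.toMatrix_apply, Algebra.algebraMap_eq_smul_one]

end FormSimilitude

/-! ### Rational similitudes between the spaces `V_{2d}` -/

section ScaledCongruence

variable {R n n' p p' : Type*} [CommRing R] {m m' : R}

/-- The Gram matrix `A` is `m` times the pullback of the Gram matrix `B` along a linear map. -/
def IsScaledCongruent [Fintype n'] (m : R) (A : Matrix n n R) (B : Matrix n' n' R) : Prop :=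
  ∃ T : Matrix n' n R, A = m • (T.transpose * B * T)

namespace IsScaledCongruent

theorem trans [Fintype n'] [Fintype p] {A : Matrix n n R} {B : Matrix n' n' R} {C : Matrix p p R}
    (hAB : IsScaledCongruent m A B) (hBC : IsScaledCongruent m' B C) :
    IsScaledCongruent (m * m') A C := by
  obtain ⟨T, rfl⟩ := hAB
  obtain ⟨T', rfl⟩ := hBC
  exact ⟨T' * T, by
    simp only [Matrix.transpose_mul, Matrix.mul_smul, Matrix.smul_mul, smul_smul, Matrix.mul_assoc]⟩

theorem fromBlocks [Fintype n'] [Fintype p'] {A : Matrix n n R} {B : Matrix n' n' R}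
    {A' : Matrix p p R} {B' : Matrix p' p' R}
    (h : IsScaledCongruent m A B) (h' : IsScaledCongruent m A' B') :
    IsScaledCongruent m (Matrix.fromBlocks A 0 0 A') (Matrix.fromBlocks B 0 0 B') := by
  obtain ⟨T, rfl⟩ := h
  obtain ⟨T', rfl⟩ := h'
  exact ⟨Matrix.fromBlocks T 0 0 T', by
    simp [Matrix.fromBlocks_transpose, Matrix.fromBlocks_multiply, Matrix.fromBlocks_smul]⟩

theorem one_of_equiv [Fintype n'] [DecidableEq n] [DecidableEq n'] (e : n ≃ n') :
    IsScaledCongruent (1 : R) (1 : Matrix n n R) (1 : Matrix n' n' R) :=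
  ⟨(1 : Matrix n' n' R).submatrix id e, by
    rw [one_smul, Matrix.mul_one, Matrix.transpose_submatrix, Matrix.transpose_one,
      ← Matrix.submatrix_mul _ _ _ _ _ Function.bijective_id, Matrix.mul_one,
      Matrix.submatrix_one_equiv]⟩

theorem isUnit_det_of_eq_smul [Fintype n] [DecidableEq n] {A B T : Matrix n n R}
    (h : A = m • (T.transpose * B * T)) (hA : IsUnit A.det) : IsUnit T.det := by
  rw [h, Matrix.det_smul, Matrix.det_mul] at hA
  exact isUnit_of_mul_isUnit_right (isUnit_of_mul_isUnit_right hA)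

theorem symm [Fintype n] [DecidableEq n] {A B : Matrix n n R} (h : IsScaledCongruent m A B)
    (hA : IsUnit A.det) (hm : m' * m = 1) : IsScaledCongruent m' B A := by
  obtain ⟨T, hT⟩ := h
  have hunit := isUnit_det_of_eq_smul hT hA
  refine ⟨T⁻¹, ?_⟩
  rw [hT, Matrix.mul_smul, Matrix.smul_mul, smul_smul, hm, one_smul, Matrix.transpose_nonsing_inv,
    Matrix.mul_assoc, Matrix.mul_nonsing_inv_cancel_right _ _ hunit,
    Matrix.nonsing_inv_mul_cancel_left _ _ (T.isUnit_det_transpose hunit)]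

theorem exists_isFormSimilitude [Fintype n] [DecidableEq n] {A B : Matrix n n R}
    (h : IsScaledCongruent m A B) (hA : IsUnit A.det) :
    ∃ g : (n → R) ≃ₗ[R] (n → R), IsFormSimilitude m (Matrix.toBilin' A) (Matrix.toBilin' B) g := by
  obtain ⟨T, hT⟩ := h
  have hunit : IsUnit T := (Matrix.isUnit_iff_isUnit_det T).2 (isUnit_det_of_eq_smul hT hA)
  refine ⟨Matrix.toLinearEquiv' T hunit.invertible, fun x y => ?_⟩
  change _ = m * Matrix.toBilin' B (T.mulVec x) (T.mulVec y)
  simp only [Matrix.toBilin'_apply', hT, Matrix.smul_mulVec, dotProduct_smul, smul_eq_mul,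
    ← Matrix.mulVec_mulVec, Matrix.dotProduct_mulVec, Matrix.vecMul_transpose]

end IsScaledCongruent

theorem isScaledCongruent_one_fin_four (a b c d : R) (h : m * (a ^ 2 + b ^ 2 + c ^ 2 + d ^ 2) = 1) :
    IsScaledCongruent m (1 : Matrix (Fin 4) (Fin 4) R) (1 : Matrix (Fin 4) (Fin 4) R) := by
  -- Left multiplication by the quaternion `a + bi + cj + dk`, whose norm is multiplicative.
  let Q : Matrix (Fin 4) (Fin 4) R := !![a, -b, -c, -d; b, a, -d, c; c, d, a, -b; d, -c, b, a]
  have hQ : Q.transpose * Q = (a ^ 2 + b ^ 2 + c ^ 2 + d ^ 2) • 1 := by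
    ext i j
    fin_cases i <;> fin_cases j <;> simp [Q, Matrix.mul_apply, Fin.sum_univ_four] <;> ring
  exact ⟨Q, by rw [Matrix.mul_one, hQ, smul_smul, h, one_smul]⟩

theorem isScaledCongruent_fin_one {x y : R} (ρ : R) (h : x = m * y * ρ ^ 2) :
    IsScaledCongruent m !![x] !![y] := by
  refine ⟨!![ρ], ?_⟩
  ext i j
  fin_cases i
  fin_cases j
  simp only [h, Matrix.smul_apply, Matrix.mul_apply, Finset.univ_unique, Finset.sum_singleton]
  simp
  ring

theorem isScaledCongruent_gramU (h : m' * m = 1) :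
    IsScaledCongruent m (gramU.map (Int.cast : ℤ → R)) (gramU.map (Int.cast : ℤ → R)) := by
  refine ⟨!![m', 0; 0, 1], ?_⟩
  ext i j
  fin_cases i <;> fin_cases j <;>
    simp [gramU, Matrix.mul_apply, Fin.sum_univ_two, h, mul_comm m]

end ScaledCongruence

theorem exists_sum_four_squares_eq {m : ℚ} (hm : 0 ≤ m) :
    ∃ a b c d : ℚ, a ^ 2 + b ^ 2 + c ^ 2 + d ^ 2 = m := by
  obtain ⟨a, b, c, d, h⟩ := Nat.sum_four_squares (m.num.toNat * m.den)
  have hnum : (m.num.toNat : ℚ) = m.num := by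
    exact_mod_cast Int.toNat_of_nonneg (Rat.num_nonneg.2 hm)
  have hden : (m.den : ℚ) ≠ 0 := by exact_mod_cast m.den_nz
  have hsum : (a : ℚ) ^ 2 + b ^ 2 + c ^ 2 + d ^ 2 = m.num * m.den := by
    rw [← hnum]
    exact_mod_cast h
  refine ⟨a / m.den, b / m.den, c / m.den, d / m.den, ?_⟩
  calc (a / m.den : ℚ) ^ 2 + (b / m.den) ^ 2 + (c / m.den) ^ 2 + (d / m.den) ^ 2
      = (a ^ 2 + b ^ 2 + c ^ 2 + d ^ 2) / m.den ^ 2 := by ring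
    _ = m := by rw [hsum, pow_two, mul_div_mul_right _ _ hden, Rat.num_div_den]

/-- The simple roots of `E₈` in the standard coordinates of `ℚ⁸`, as columns. -/
def rootsE₈ : Matrix (Fin 8) (Fin 8) ℚ :=
  !![1/2, 1, -1, 0, 0, 0, 0, 0;
    -1/2, 1, 1, -1, 0, 0, 0, 0;
    -1/2, 0, 0, 1, -1, 0, 0, 0;
    -1/2, 0, 0, 0, 1, -1, 0, 0;
    -1/2, 0, 0, 0, 0, 1, -1, 0;
    -1/2, 0, 0, 0, 0, 0, 1, -1;
    -1/2, 0, 0, 0, 0, 0, 0, 1;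
    1/2, 0, 0, 0, 0, 0, 0, 0]

theorem transpose_rootsE₈_mul_rootsE₈ :
    rootsE₈.transpose * rootsE₈ = CartanMatrix.E₈.map (Int.cast : ℤ → ℚ) := by
  ext i j
  fin_cases i <;> fin_cases j <;>
    simp [rootsE₈, CartanMatrix.E₈, Matrix.mul_apply, Fin.sum_univ_eight] <;> norm_num

theorem isScaledCongruent_one_fin_eight {m : ℚ} (hm : 0 < m) :
    IsScaledCongruent m (1 : Matrix (Fin 8) (Fin 8) ℚ) (1 : Matrix (Fin 8) (Fin 8) ℚ) := by
  obtain ⟨a, b, c, d, h⟩ := exists_sum_four_squares_eq (inv_pos.2 hm).le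
  have h₄ := isScaledCongruent_one_fin_four a b c d (h ▸ mul_inv_cancel₀ hm.ne')
  have h₄₄ := h₄.fromBlocks h₄
  rw [Matrix.fromBlocks_one] at h₄₄
  let e : Fin 4 ⊕ Fin 4 ≃ Fin 8 := finSumFinEquiv
  simpa using ((IsScaledCongruent.one_of_equiv e.symm).trans h₄₄).trans (.one_of_equiv e)

theorem isScaledCongruent_E₈ {m : ℚ} (hm : 0 < m) :
    IsScaledCongruent m (CartanMatrix.E₈.map (Int.cast : ℤ → ℚ))
      (CartanMatrix.E₈.map (Int.cast : ℤ → ℚ)) := by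
  have hdet : IsUnit (CartanMatrix.E₈.map (Int.cast : ℤ → ℚ)).det := by
    simp [← Int.cast_det, CartanMatrix.E₈_det]
  have hroots : IsScaledCongruent 1 (CartanMatrix.E₈.map (Int.cast : ℤ → ℚ)) 1 :=
    ⟨rootsE₈, by rw [one_smul, Matrix.mul_one, transpose_rootsE₈_mul_rootsE₈]⟩
  simpa using (hroots.trans (isScaledCongruent_one_fin_eight hm)).trans
    (hroots.symm hdet (one_mul 1))

theorem isScaledCongruent_gram {d e : ℕ} {m ρ : ℚ} (hm : 0 < m) (h : (d : ℚ) = m * e * ρ ^ 2) :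
    IsScaledCongruent m ((gram d).map (Int.cast : ℤ → ℚ)) ((gram e).map (Int.cast : ℤ → ℚ)) := by
  have hU := isScaledCongruent_gramU (inv_mul_cancel₀ hm.ne')
  have hE := isScaledCongruent_E₈ hm
  have hcast (k : ℕ) : (!![2 * (k : ℤ)]).map (Int.cast : ℤ → ℚ) = !![2 * (k : ℚ)] := by
    ext i j
    simp
  have hline : IsScaledCongruent m ((!![2 * (d : ℤ)]).map (Int.cast : ℤ → ℚ))
      ((!![2 * (e : ℤ)]).map (Int.cast : ℤ → ℚ)) := by
    rw [hcast, hcast]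
    exact isScaledCongruent_fin_one ρ (by rw [h]; ring)
  simpa [gram, Matrix.fromBlocks_map] using
    hline.fromBlocks ((hU.fromBlocks hU).fromBlocks (hE.fromBlocks hE))

theorem det_gram (d : ℕ) : (gram d).det = 2 * d := by
  simp [gram, gramU, Matrix.det_fromBlocks_zero₂₁, CartanMatrix.E₈_det, Matrix.det_fin_two]

theorem exists_isFormSimilitude_ψ {d e : ℕ} (hd : 0 < d) {m ρ : ℚ} (hm : 0 < m)
    (h : (d : ℚ) = m * e * ρ ^ 2) :
    ∃ g : V ≃ₗ[ℚ] V, IsFormSimilitude m (ψ d) (ψ e) g := by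
  refine (isScaledCongruent_gram hm h).exists_isFormSimilitude ?_
  rw [← Int.cast_det, det_gram, isUnit_iff_ne_zero]
  exact_mod_cast mul_ne_zero two_ne_zero hd.ne'

theorem natCast_eq_of_isFormSimilitude_ψ {R : Type*} [CommRing R] [Algebra ℚ R] {d e : ℕ} {t : R}
    {g : (R ⊗[ℚ] V) ≃ₗ[R] (R ⊗[ℚ] V)}
    (hg : IsFormSimilitude t ((ψ d).baseChange R) ((ψ e).baseChange R) g) :
    (d : R) = t ^ 21 * LinearMap.det (g : (R ⊗[ℚ] V) →ₗ[R] (R ⊗[ℚ] V)) ^ 2 * e := by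
  have hgram (k : ℕ) : (LinearMap.BilinForm.toMatrix
      (Algebra.TensorProduct.basis R (Pi.basisFun ℚ Idx)) ((ψ k).baseChange R)).det = 2 * k := by
    rw [toMatrix_baseChange, ← RingHom.mapMatrix_apply, ← RingHom.map_det,
      LinearMap.BilinForm.toMatrix_basisFun, ψ, LinearMap.BilinForm.toMatrix'_toBilin',
      ← Int.cast_det, det_gram, Int.cast_mul, map_mul, Int.cast_ofNat, map_ofNat, Int.cast_natCast,
      map_natCast]
  have hdet := hg.det_toMatrix (Algebra.TensorProduct.basis R (Pi.basisFun ℚ Idx))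
  rw [hgram, hgram, show Fintype.card Idx = 21 from rfl] at hdet
  have htwo : IsUnit (2 : R) := by
    rw [← map_ofNat (algebraMap ℚ R)]
    exact (isUnit_iff_ne_zero.2 two_ne_zero).map _
  exact htwo.mul_left_cancel (hdet.trans (by ring))

/-! ### Markings -/

theorem nontrivial_finiteAdeleRing {R : Type*} (F : Type*) [CommRing R] [IsDedekindDomain R]
    [Field F] [Algebra R F] [IsFractionRing R F] (hR : ¬IsField R) :
    Nontrivial (IsDedekindDomain.FiniteAdeleRing R F) := by
  let v : IsDedekindDomain.HeightOneSpectrum R :=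
    (IsDedekindDomain.HeightOneSpectrum.equivMaximalSpectrum hR).symm (Classical.arbitrary _)
  exact ⟨0, 1, fun h => zero_ne_one (congrArg (fun f => f v) h)⟩

instance : Nontrivial Af := nontrivial_finiteAdeleRing ℚ Int.not_isField

theorem HasRationalDet.exists_det_eq {W : Type} [AddCommGroup W] [Module ℚ W]
    {α : (Af ⊗[ℚ] V) ≃ₗ[Af] (Af ⊗[ℚ] W)} (hα : HasRationalDet α) (a : W ≃ₗ[ℚ] V) :
    ∃ r : ℚ, LinearMap.det ((α ≪≫ₗ bc Af a : (Af ⊗[ℚ] V) ≃ₗ[Af] (Af ⊗[ℚ] V)) :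
      (Af ⊗[ℚ] V) →ₗ[Af] (Af ⊗[ℚ] V)) = algebraMap ℚ Af r := by
  obtain ⟨u, r, hr⟩ := hα
  refine ⟨LinearMap.det ((u ≪≫ₗ a : V ≃ₗ[ℚ] V) : V →ₗ[ℚ] V) * r, ?_⟩
  rw [map_mul, ← hr, ← det_baseChange_linearEquiv, ← LinearMap.det_comp]
  congr 1
  ext x
  simp [bc_trans]

section Rescaling

variable {d e : ℕ} {W : Type} [AddCommGroup W] [Module ℚ W] {s : LinearMap.BilinForm ℚ W} {m : ℚ}
  {α : (Af ⊗[ℚ] V) ≃ₗ[Af] (Af ⊗[ℚ] W)}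

theorem IsSimilitude.exists_isFormSimilitude_inv (hα : IsSimilitude d s m α)
    (hdet : HasRationalDet α) (hd : 0 < d) (hm : 0 < m) {u : W ≃ₗ[ℚ] V}
    (hu : IsFormSimilitude 1 s (ψ e) u) :
    ∃ a : W ≃ₗ[ℚ] V, IsFormSimilitude m⁻¹ s (ψ d) a := by
  obtain ⟨r, hr⟩ := hdet.exists_det_eq u
  have hdisc : (d : ℚ) = m ^ 21 * r ^ 2 * e := by
    have h := natCast_eq_of_isFormSimilitude_ψ (IsFormSimilitude.trans hα (hu.baseChange Af))
    rw [hr] at h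
    apply (algebraMap ℚ Af).injective
    simpa using h
  -- `m ^ 21` is `m` times the square of `m ^ 10`.
  obtain ⟨T, hT⟩ := exists_isFormSimilitude_ψ (ρ := m ^ 10 * r) hd hm (hdisc.trans (by ring))
  exact ⟨u ≪≫ₗ T.symm, one_mul m⁻¹ ▸ hu.trans (hT.symm (inv_mul_cancel₀ hm.ne'))⟩

theorem IsSimilitude.isFormSimilitude_one (hα : IsSimilitude d s m α) (hm : m ≠ 0)
    {a : W ≃ₗ[ℚ] V} (ha : IsFormSimilitude m⁻¹ s (ψ d) a) :
    IsFormSimilitude 1 ((ψ d).baseChange Af) ((ψ d).baseChange Af) (α ≪≫ₗ bc Af a) := by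
  have h := IsFormSimilitude.trans hα (ha.baseChange Af)
  rwa [← map_mul, mul_inv_cancel₀ hm, map_one] at h

theorem det_neg_V : LinearMap.det ((LinearEquiv.neg ℚ : V ≃ₗ[ℚ] V) : V →ₗ[ℚ] V) = -1 := by
  have hneg : ((LinearEquiv.neg ℚ : V ≃ₗ[ℚ] V) : V →ₗ[ℚ] V) = (-1 : ℚ) • LinearMap.id := by
    ext
    simp
  rw [hneg, LinearMap.det_smul, LinearMap.det_id, Module.finrank_fintype_fun_eq_card, mul_one]
  exact Odd.neg_one_pow (by decide)

theorem IsSimilitude.exists_comp_mem_GAf (hα : IsSimilitude d s m α) (hdet : HasRationalDet α)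
    (hd : 0 < d) (hm : m ≠ 0) {a : W ≃ₗ[ℚ] V} (ha : IsFormSimilitude m⁻¹ s (ψ d) a) :
    ∃ a' : W ≃ₗ[ℚ] V, IsFormSimilitude m⁻¹ s (ψ d) a' ∧ α ≪≫ₗ bc Af a' ∈ GAf d := by
  have hiso := hα.isFormSimilitude_one hm ha
  obtain ⟨t, ht⟩ := hdet.exists_det_eq a
  have hsq : t ^ 2 = 1 := by
    have h := natCast_eq_of_isFormSimilitude_ψ hiso
    have hd' : (d : ℚ) ≠ 0 := by exact_mod_cast hd.ne'
    apply mul_right_cancel₀ hd'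
    apply (algebraMap ℚ Af).injective
    rw [ht] at h
    simpa using h.symm
  rcases eq_or_eq_neg_of_sq_eq_sq t 1 (hsq.trans (one_pow 2).symm) with rfl | rfl
  · exact ⟨a, ha, mem_SO_iff.2 ⟨hiso, by rw [ht, map_one]⟩⟩
  · have ha' : IsFormSimilitude m⁻¹ s (ψ d) (a ≪≫ₗ LinearEquiv.neg ℚ) :=
      mul_one m⁻¹ ▸ ha.trans isFormSimilitude_neg
    refine ⟨_, ha', mem_SO_iff.2 ⟨hα.isFormSimilitude_one hm ha', ?_⟩⟩
    rw [bc_trans, ← LinearEquiv.trans_assoc, LinearEquiv.coe_trans, LinearMap.det_comp, ht,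
      det_baseChange_linearEquiv, det_neg_V, map_neg, map_one, neg_mul_neg, one_mul]

end Rescaling

variable {d : ℕ} {K : Subgroup (GAf d)}

theorem IsSimilitude.trans_left {W : Type} [AddCommGroup W] [Module ℚ W]
    {s : LinearMap.BilinForm ℚ W} {m : ℚ} {α : (Af ⊗[ℚ] V) ≃ₗ[Af] (Af ⊗[ℚ] W)}
    (hα : IsSimilitude d s m α) {k : (Af ⊗[ℚ] V) ≃ₗ[Af] (Af ⊗[ℚ] V)} (hk : k ∈ GAf d) :
    IsSimilitude d s m (k ≪≫ₗ α) :=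
  fun x y => (hk.1 x y).symm.trans (hα (k x) (k y))

theorem HasRationalDet.trans_left {W : Type} [AddCommGroup W] [Module ℚ W]
    {α : (Af ⊗[ℚ] V) ≃ₗ[Af] (Af ⊗[ℚ] W)} (hα : HasRationalDet α)
    {k : (Af ⊗[ℚ] V) ≃ₗ[Af] (Af ⊗[ℚ] V)} (hk : k ∈ GAf d) : HasRationalDet (k ≪≫ₗ α) := by
  obtain ⟨u, r, hr⟩ := hα
  refine ⟨u, r, ?_⟩
  rw [LinearEquiv.trans_assoc, LinearEquiv.coe_trans, LinearMap.det_comp, hr, hk.2, mul_one]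

theorem HK.exists_marking (hd : 0 < d) (X : HK d K) {α : (Af ⊗[ℚ] V) ≃ₗ[Af] (Af ⊗[ℚ] X.W)}
    (hα : α ∈ X.level) : ∃ M : X.Marking, M.α = α := by
  obtain ⟨β, ⟨m, hm, hβ⟩, hβdet, hlevel⟩ := X.isLevel
  obtain ⟨k, -, rfl⟩ := hlevel ▸ hα
  have hsim := hβ.trans_left k.2
  have hdet := hβdet.trans_left k.2
  obtain ⟨e, -, hX⟩ := X.isPolarizedK3
  obtain ⟨u, hu⟩ := hX.equivalent
  obtain ⟨a, ha⟩ := hsim.exists_isFormSimilitude_inv hdet hd hm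
    fun x y => (hu x y).symm.trans (one_mul _).symm
  obtain ⟨a', ha', hmem⟩ := hsim.exists_comp_mem_GAf hdet hd hm.ne' ha
  exact ⟨⟨_, hα, m, hm, hsim, a', ha', hmem⟩, rfl⟩

theorem HK.nonempty_marking (hd : 0 < d) (X : HK d K) : Nonempty X.Marking :=
  let ⟨_, hα⟩ := X.level_nonempty
  let ⟨M, _⟩ := X.exists_marking hd hα
  ⟨M⟩

/-! ### Transport of Hodge structures -/

section Transport

theorem eigenspace_conj {R M M' : Type*} [CommRing R] [AddCommGroup M] [Module R M]
    [AddCommGroup M'] [Module R M'] (e : M ≃ₗ[R] M') (f : Module.End R M) (μ : R) :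
    Module.End.eigenspace (e.conj f) μ = (Module.End.eigenspace f μ).map (e : M →ₗ[R] M') := by
  ext y
  obtain ⟨x, rfl⟩ := e.surjective y
  rw [Submodule.map_equiv_eq_comap_symm]
  simp [← map_smul]

variable {W W' : Type} [AddCommGroup W] [Module ℚ W] [AddCommGroup W'] [Module ℚ W']
  {s : LinearMap.BilinForm ℚ W} {s' : LinearMap.BilinForm ℚ W'} {c : ℚ} {h : Rep W}

theorem transport_apply (a : W ≃ₗ[ℚ] W') (h : Rep W) (z : ℂˣ) (x : ℝ ⊗[ℚ] W) :
    transport a h z (bc ℝ a x) = bc ℝ a (h z x) := by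
  simp [transport]

theorem transport_mem_SO {a : W ≃ₗ[ℚ] W'} (ha : IsFormSimilitude c s s' a) (hc : c ≠ 0) {z : ℂˣ}
    (hz : h z ∈ SO (s.baseChange ℝ)) : transport a h z ∈ SO (s'.baseChange ℝ) :=
  (ha.baseChange ℝ).conj_mem_SO (IsRegular.of_ne_zero (by simpa using hc)).left hz

theorem IsPolarization.transport {a : W ≃ₗ[ℚ] W'} (hh : IsPolarization s h)
    (ha : IsFormSimilitude c s s' a) (hc : 0 < c) : IsPolarization s' (transport a h) := by
  have haℝ := ha.baseChange ℝ
  have hcℝ : (0 : ℝ) < algebraMap ℚ ℝ c := by simpa using hc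
  refine ⟨fun z x y => ?_, fun x y => ?_, fun x hx => ?_⟩
  all_goals obtain ⟨x, rfl⟩ := (bc ℝ a).surjective x
  · obtain ⟨y, rfl⟩ := (bc ℝ a).surjective y
    apply mul_left_cancel₀ hcℝ.ne'
    rw [transport_apply, transport_apply, ← haℝ, ← haℝ, hh.invariant]
  · obtain ⟨y, rfl⟩ := (bc ℝ a).surjective y
    apply mul_left_cancel₀ hcℝ.ne'
    rw [transport_apply, transport_apply, ← haℝ, ← haℝ, hh.symm]
  · apply (mul_pos_iff_of_pos_left hcℝ).1
    rw [transport_apply, ← haℝ]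
    exact hh.pos x (by rintro rfl; exact hx (map_zero _))

theorem hodgePiece_transport (a : W ≃ₗ[ℚ] W') (h : Rep W) (p q : ℤ) :
    hodgePiece (transport a h) p q =
      (hodgePiece h p q).map ((bc ℝ a).baseChange ℝ ℂ _ _).toLinearMap := by
  have hconj (z : ℂˣ) : (transport a h z).toLinearMap.baseChange ℂ =
      ((bc ℝ a).baseChange ℝ ℂ _ _).conj ((h z).toLinearMap.baseChange ℂ) := by
    ext x
    simp [transport]
  simp only [hodgePiece, hconj, eigenspace_conj]
  exact ((Submodule.orderIsoMapComap ((bc ℝ a).baseChange ℝ ℂ _ _)).map_iInf _).symm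

theorem IsK3HodgeStructure.transport (hh : IsK3HodgeStructure h) (a : W ≃ₗ[ℚ] W') :
    IsK3HodgeStructure (transport a h) where
  type_eq := by
    simp only [hodgePiece_transport, ← Submodule.map_sup, hh.type_eq, Submodule.map_top,
      LinearEquiv.range]
  finrank_neg := by rw [hodgePiece_transport, LinearEquiv.finrank_map_eq, hh.finrank_neg]
  finrank_zero := by rw [hodgePiece_transport, LinearEquiv.finrank_map_eq, hh.finrank_zero]
  finrank_pos := by rw [hodgePiece_transport, LinearEquiv.finrank_map_eq, hh.finrank_pos]

end Transport

/-! ### The sign of the polarization -/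

section Sign

theorem finrank_eigenspace_baseChange {F : Type*} (L : Type*) {M : Type*} [Field F] [Field L]
    [Algebra F L] [AddCommGroup M] [Module F M] (f : Module.End F M) (μ : F) :
    Module.finrank L (Module.End.eigenspace (f.baseChange L) (algebraMap F L μ)) =
      Module.finrank F (Module.End.eigenspace f μ) := by
  have hsub : f.baseChange L - algebraMap F L μ • 1 = (f - μ • 1).baseChange L := by
    ext x
    simp [Algebra.algebraMap_eq_smul_one]
  rw [Module.End.eigenspace_def, Module.End.eigenspace_def, hsub]
  exact (LinearMap.tensorKerEquiv L L (f - μ • 1)).finrank_eq.symm.trans Module.finrank_baseChange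

theorem card_le_sigPos_of_isOrthoᵢ {F M ι : Type*} [Field F] [LinearOrder F]
    [IsStrictOrderedRing F] [AddCommGroup M] [Module F M] [FiniteDimensional F M] [Fintype ι]
    {B : LinearMap.BilinForm F M} {v : ι → M} (hv : B.IsOrthoᵢ v) (hpos : ∀ i, 0 < B (v i) (v i)) :
    Fintype.card ι ≤ sigPos B.toQuadraticMap := by
  have hli := LinearMap.linearIndependent_of_isOrthoᵢ hv fun i => (hpos i).ne'
  rw [← finrank_span_eq_card hli]
  apply le_sigPos_of_posDef
  rintro ⟨x, hx⟩ hx0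
  obtain ⟨c, rfl⟩ := (Submodule.mem_span_range_iff_exists_fun F).1 hx
  have hform : B (∑ i, c i • v i) (∑ i, c i • v i) = ∑ i, c i ^ 2 * B (v i) (v i) := by
    simp only [map_sum, map_smul, LinearMap.sum_apply, LinearMap.smul_apply, smul_eq_mul]
    refine Finset.sum_congr rfl fun i _ => ?_
    rw [Finset.sum_eq_single i (fun j _ hji => by rw [hv hji, mul_zero]) (by simp)]
    ring
  obtain ⟨i, hi⟩ : ∃ i, c i ≠ 0 := by
    by_contra! hc
    exact hx0 (Subtype.ext (by simp [hc]))
  change 0 < B _ _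
  rw [hform]
  exact Finset.sum_pos' (fun j _ => mul_nonneg (sq_nonneg _) (hpos j).le)
    ⟨i, Finset.mem_univ _, mul_pos (by positivity) (hpos i)⟩

theorem finrank_hodgePiece_zero_zero_le {W : Type} [AddCommGroup W] [Module ℚ W]
    [FiniteDimensional ℚ W] (h : Rep W) (z : ℂˣ) :
    Module.finrank ℂ (hodgePiece h 0 0) ≤
      Module.finrank ℝ (Module.End.eigenspace (h z).toLinearMap 1) := by
  rw [← finrank_eigenspace_baseChange ℂ]
  apply Submodule.finrank_mono
  exact (iInf_le _ z).trans (by simp)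

theorem IsPolarization.sigPos_add_finrank_le {W : Type} [AddCommGroup W] [Module ℚ W]
    [FiniteDimensional ℚ W] {s : LinearMap.BilinForm ℚ W} {h : Rep W}
    (hpol : IsPolarization (-s) h) :
    sigPos (s.baseChange ℝ).toQuadraticMap + Module.finrank ℂ (hodgePiece h 0 0) ≤
      Module.finrank ℚ W := by
  have hneg : (-s).baseChange ℝ = -s.baseChange ℝ := by
    ext x y
    simp
  have hnonpos : ∀ x ∈ Module.End.eigenspace (h unitI).toLinearMap 1,
      (s.baseChange ℝ).toQuadraticMap x ≤ 0 := by
    intro x hx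
    have hfix : h unitI x = x := by simpa using Module.End.mem_eigenspace_iff.1 hx
    rcases eq_or_ne x 0 with rfl | hx0
    · exact (QuadraticMap.map_zero _).le
    · have hpos := hpol.pos x hx0
      rw [hfix, hneg] at hpos
      exact (neg_pos.1 hpos).le
  calc sigPos (s.baseChange ℝ).toQuadraticMap + Module.finrank ℂ (hodgePiece h 0 0)
      ≤ sigPos (s.baseChange ℝ).toQuadraticMap +
          Module.finrank ℝ (Module.End.eigenspace (h unitI).toLinearMap 1) :=
        Nat.add_le_add_left (finrank_hodgePiece_zero_zero_le h unitI) _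
    _ ≤ Module.finrank ℝ (ℝ ⊗[ℚ] W) := QuadraticForm.sigPos_add_finrank_le_of_nonpos hnonpos
    _ = Module.finrank ℚ W := Module.finrank_baseChange

/-- Pairwise orthogonal vectors of positive length in `V_{2d}`, spanning `⟨2d⟩` and the diagonals
of the two hyperbolic planes. -/
def positiveVectors : Fin 3 → V :=
  ![Pi.single (Sum.inl 0) 1,
    Pi.single (Sum.inr (Sum.inl (Sum.inl 0))) 1 + Pi.single (Sum.inr (Sum.inl (Sum.inl 1))) 1,
    Pi.single (Sum.inr (Sum.inl (Sum.inr 0))) 1 + Pi.single (Sum.inr (Sum.inl (Sum.inr 1))) 1]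

theorem ψ_positiveVectors (d : ℕ) (i j : Fin 3) :
    ψ d (positiveVectors i) (positiveVectors j) = Matrix.diagonal ![2 * (d : ℚ), 2, 2] i j := by
  fin_cases i <;> fin_cases j <;>
    simp [positiveVectors, ψ, Matrix.toBilin'_single, gram, gramU] <;>
    norm_num

theorem three_le_sigPos_ψ {d : ℕ} (hd : 0 < d) :
    3 ≤ sigPos ((ψ d).baseChange ℝ).toQuadraticMap := by
  refine card_le_sigPos_of_isOrthoᵢ (v := fun i : Fin 3 => (1 : ℝ) ⊗ₜ[ℚ] positiveVectors i)
    (fun i j hij => ?_) (fun i => ?_)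
  · change ((ψ d).baseChange ℝ) (1 ⊗ₜ positiveVectors i) (1 ⊗ₜ positiveVectors j) = 0
    simp [ψ_positiveVectors, hij]
  · fin_cases i <;> simp [ψ_positiveVectors, hd]

theorem not_isPolarization_neg {d : ℕ} (hd : 0 < d) {h : Rep V} (hh : IsK3HodgeStructure h) :
    ¬ IsPolarization (-ψ d) h := by
  intro hpol
  have hle := hpol.sigPos_add_finrank_le
  rw [hh.finrank_zero, Module.finrank_fintype_fun_eq_card, show Fintype.card Idx = 21 from rfl]
    at hle
  have := three_le_sigPos_ψ hd
  omega

theorem isPolarizedK3OfDegree_of_mem_Ω {d : ℕ} (hd : 0 < d) {x : Rep V} (hx : x ∈ Ω d) :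
    IsPolarizedK3OfDegree d (ψ d) x where
  mem_SO := hx.1
  hodge := hx.2.1
  polarization := hx.2.2.resolve_right (not_isPolarization_neg hd hx.2.1)
  equivalent := ⟨LinearEquiv.refl ℚ V, fun _ _ => rfl⟩

end Sign

/-! ### The period map -/

theorem HK.Marking.transport_mem_Ω {X : HK d K} (M : X.Marking) : transport M.a X.h ∈ Ω d := by
  obtain ⟨e, -, hX⟩ := X.isPolarizedK3
  have hm := inv_pos.2 M.m_pos
  exact ⟨fun z => transport_mem_SO M.form_eq hm.ne' (hX.mem_SO z), hX.hodge.transport M.a,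
    Or.inl (hX.polarization.transport M.form_eq hm)⟩

/-- The period point `[a · h, a ∘ α]_K` of a marked object. -/
def HK.Marking.point {X : HK d K} (M : X.Marking) : Sh d K :=
  Sh.mk K ⟨transport M.a X.h, M.transport_mem_Ω⟩ ⟨M.α ≪≫ₗ bc Af M.a, M.comp_mem⟩

theorem HK.Marking.point_eq_of_iso {X Y : HK d K} (h : X.Iso Y) (M : X.Marking)
    (N : Y.Marking) : M.point = N.point := by
  obtain ⟨b, hb, -, α, hα, hαb⟩ := h
  obtain ⟨k₁, hk₁, rfl⟩ := (X.level_mem M.α_mem).1 hα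
  obtain ⟨k₂, hk₂, hNα⟩ := (Y.level_mem hαb).1 N.α_mem
  let q : V ≃ₗ[ℚ] V := M.a.symm ≪≫ₗ b ≪≫ₗ N.a
  have hcomp : N.α ≪≫ₗ bc Af N.a =
      bc Af q * (M.α ≪≫ₗ bc Af M.a) * (k₁ * k₂ : GAf d) := by
    rw [hNα]
    ext x
    simp [q, bc_trans, bc_symm]
  have hq : q ∈ GQ d := by
    rw [← baseChange_mem_SO_iff Af, ← (GAf d).mul_mem_cancel_right M.comp_mem,
      ← (GAf d).mul_mem_cancel_right (k₁ * k₂).2]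
    exact hcomp ▸ N.comp_mem
  have htransport : transport N.a Y.h = transport q (transport M.a X.h) := by
    rw [← hb, ← transport_trans, ← transport_trans, ← LinearEquiv.trans_assoc,
      ← LinearEquiv.trans_assoc, LinearEquiv.self_trans_symm, LinearEquiv.refl_trans]
  exact Quotient.sound ⟨q, hq, k₁ * k₂, mul_mem hk₁ hk₂, htransport, hcomp⟩

theorem HK.Marking.iso_of_point_eq {X Y : HK d K} (M : X.Marking) (N : Y.Marking)
    (h : M.point = N.point) : X.Iso Y := by
  obtain ⟨q, hq, k, hk, htransport, hcomp⟩ := Quotient.exact h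
  dsimp only at htransport hcomp
  refine ⟨M.a ≪≫ₗ q ≪≫ₗ N.a.symm, ?_, ⟨M.m⁻¹ * N.m, mul_ne_zero (inv_ne_zero M.m_pos.ne')
    N.m_pos.ne', fun x y => ?_⟩, M.α, M.α_mem, ?_⟩
  · rw [transport_trans, transport_trans]
    exact transport_symm htransport
  · rw [M.form_eq, N.form_eq, mul_assoc, mul_inv_cancel_left₀ N.m_pos.ne']
    simp [hq.1]
  · refine (Y.level_mem N.α_mem).2 ⟨k⁻¹, inv_mem hk, ?_⟩
    have hcomp' : bc Af q * (M.α ≪≫ₗ bc Af M.a) = (N.α ≪≫ₗ bc Af N.a) * (k⁻¹ : GAf d) := by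
      rw [hcomp, Subgroup.coe_inv, mul_inv_cancel_right]
    ext x
    apply (bc Af N.a).injective
    simpa [bc_trans, bc_symm] using LinearEquiv.congr_fun hcomp' x

theorem trans_bc_refl (g : (Af ⊗[ℚ] V) ≃ₗ[Af] (Af ⊗[ℚ] V)) :
    g ≪≫ₗ bc Af (LinearEquiv.refl ℚ V) = g := by
  rw [bc_refl, LinearEquiv.trans_refl]

/-- The object `((V_{2d}, x), ψ_{2d}, gK)`. -/
def HK.ofPoint (hd : 0 < d) (K : Subgroup (GAf d)) (x : Ω d) (g : GAf d) : HK d K where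
  W := V
  h := x
  s := ψ d
  isPolarizedK3 := ⟨d, hd, isPolarizedK3OfDegree_of_mem_Ω hd x.2⟩
  level := {β | ∃ k ∈ K, β = (k : (Af ⊗[ℚ] V) ≃ₗ[Af] (Af ⊗[ℚ] V)) ≪≫ₗ g}
  isLevel := by
    refine ⟨g, ⟨1, one_pos, fun v w => ?_⟩, ⟨LinearEquiv.refl ℚ V, 1, ?_⟩, rfl⟩
    · rw [map_one, one_mul, g.2.1]
    · rw [bc_refl, map_one]
      exact g.2.2

/-- The identity of `V_{2d}` as a marking of `((V_{2d}, x), ψ_{2d}, gK)`. -/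
def HK.ofPointMarking (hd : 0 < d) (K : Subgroup (GAf d)) (x : Ω d) (g : GAf d) :
    (HK.ofPoint hd K x g).Marking where
  α := g.1
  α_mem := ⟨1, one_mem _, rfl⟩
  m := 1
  m_pos := one_pos
  similitude v w := by
    rw [map_one, one_mul]
    exact (g.2.1 v w).symm
  a := LinearEquiv.refl ℚ V
  form_eq v w := by
    rw [inv_one, one_mul]
    rfl
  comp_mem := (trans_bc_refl g.1).symm ▸ g.2

theorem HK.ofPointMarking_point (hd : 0 < d) (K : Subgroup (GAf d)) (x : Ω d) (g : GAf d) :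
    (HK.ofPointMarking hd K x g).point = Sh.mk K x g := by
  unfold HK.Marking.point
  congr 1
  · exact Subtype.ext (transport_refl _)
  · exact Subtype.ext (trans_bc_refl g.1)

/-- The map `((W, h), s, αK) ↦ [a · h, a ∘ α]_K` on isomorphism classes, computed with an
arbitrary marking of each object. -/
def periodMap (hd : 0 < d) (K : Subgroup (GAf d)) : Quotient (HK.setoid d K) → Sh d K :=
  Quotient.lift (fun X => (X.nonempty_marking hd).some.point)
    fun _ _ h => HK.Marking.point_eq_of_iso h _ _

theorem periodMap_mk (hd : 0 < d) {X : HK d K} (M : X.Marking) :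
    periodMap hd K (Quotient.mk (HK.setoid d K) X) = M.point :=
  HK.Marking.point_eq_of_iso ((HK.setoid d K).refl X) _ _

theorem exists_periodMap_eq (hd : 0 < d) (p : Sh d K) :
    ∃ X : HK d K, IsPolarizedK3OfDegree d X.s X.h ∧
      periodMap hd K (Quotient.mk (HK.setoid d K) X) = p := by
  obtain ⟨⟨x, g⟩, rfl⟩ := Quotient.exists_rep p
  exact ⟨HK.ofPoint hd K x g, isPolarizedK3OfDegree_of_mem_Ω hd x.2,
    (periodMap_mk hd (HK.ofPointMarking hd K x g)).trans (HK.ofPointMarking_point hd K x g)⟩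

theorem periodMap_injective (hd : 0 < d) (K : Subgroup (GAf d)) :
    Function.Injective (periodMap hd K) := by
  rintro ⟨X⟩ ⟨Y⟩ h
  obtain ⟨M⟩ := X.nonempty_marking hd
  obtain ⟨N⟩ := Y.nonempty_marking hd
  exact Quotient.sound (M.iso_of_point_eq N
    ((periodMap_mk hd M).symm.trans (h.trans (periodMap_mk hd N))))

theorem periodMap_bijective (hd : 0 < d) (K : Subgroup (GAf d)) :
    Function.Bijective (periodMap hd K) :=
  ⟨periodMap_injective hd K, fun p =>
    let ⟨_, _, hX⟩ := exists_periodMap_eq hd p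
    ⟨_, hX⟩⟩

end K3Shimura

end

open K3Shimura in
theorem mainTheorem10_general (d : ℕ) (hd : 0 < d) (K : Subgroup (GAf d)) :
    (∀ (X : HK d K), ∀ α ∈ X.level, ∃ M : X.Marking, M.α = α) ∧
    ∃ Φ : Quotient (HK.setoid d K) → Sh d K,
      (∀ (X : HK d K) (M : X.Marking), ∃ hΩ : transport M.a X.h ∈ Ω d,
        Φ (Quotient.mk (HK.setoid d K) X) =
          Sh.mk K ⟨transport M.a X.h, hΩ⟩ ⟨M.α ≪≫ₗ bc Af M.a, M.comp_mem⟩) ∧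
      Function.Bijective Φ ∧
      ∀ p : Sh d K, ∃ X : HK d K, IsPolarizedK3OfDegree d X.s X.h ∧
        Φ (Quotient.mk (HK.setoid d K) X) = p :=
  ⟨fun X _ hα => X.exists_marking hd hα, periodMap hd K,
    fun _ M => ⟨M.transport_mem_Ω, periodMap_mk hd M⟩, periodMap_bijective hd K,
    exists_periodMap_eq hd⟩

open K3Shimura in
theorem mainTheorem10 (d : ℕ) (hd : 0 < d) (K : Subgroup (GAf d))
    (hK_open : IsOpen (K : Set (GAf d))) (hK_compact : IsCompact (K : Set (GAf d))) :
    -- the choices needed to form `[a · h, a ∘ α]_K` exist, for every representative `α`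
    (∀ (X : HK d K), ∀ α ∈ X.level, ∃ M : X.Marking, M.α = α) ∧
    -- `[a · h, a ∘ α]_K` is a point of the Shimura variety that depends only on the isomorphism
    -- class, and the resulting map is bijective
    ∃ Φ : Quotient (HK.setoid d K) → Sh d K,
      (∀ (X : HK d K) (M : X.Marking), ∃ hΩ : transport M.a X.h ∈ Ω d,
        Φ (Quotient.mk (HK.setoid d K) X) =
          Sh.mk K ⟨transport M.a X.h, hΩ⟩ ⟨M.α ≪≫ₗ bc Af M.a, M.comp_mem⟩) ∧
      Function.Bijective Φ ∧
      -- the objects of degree `2d` already represent all classes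
      ∀ p : Sh d K, ∃ X : HK d K, IsPolarizedK3OfDegree d X.s X.h ∧
        Φ (Quotient.mk (HK.setoid d K) X) = p :=
  mainTheorem10_general d hd K
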